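/- Let $K$ be a field of characteristic $p$, where $p$ is an odd prime, let $n\ge 2$, and let the alternating group $A_n$ act on the polynomial ring $R=K[X_1,\dots,X_n]$ by permuting the variables. Let $e_1,\dots,e_n$ be the elementary symmetric polynomials in $X_1,\dots,X_n$ and $\Delta=\prod_{i>j}(X_i-X_j)$. For a Noetherian ring $S$ of characteristic $p$ and an ideal $I\subseteq S$, let $I^{[q]}$ be the ideal generated by the $q$-th powers of the elements of $I$. An element $x\in S$ is in the tight closure $I^*$ if there is a $c\in S$, outside every minimal prime of $S$, such that $cx^{q}\in I^{[q]}$ for all sufficiently large powers $q=p^e$. The ring $S$ is weakly F-regular if $I^*=I$ for every ideal $I$ of $S$, and F-regular if every localization $W^{-1}S$ at a multiplicative set $W$ is weakly F-regular. Then: 1. the ring of invariants is $R^{A_n}=K[e_1,\dots,e_n,\Delta]$; 2. $R^{A_n}$ is F-regular if and only if $R^{A_n}$ is a direct summand of $R$ as an $R^{A_n}$-module; 3. $R^{A_n}$ is F-regular if and only if $p$ does not divide $|A_n|=n!/2$; 4. $\Delta\equiv n!\,X_n^{n-1}X_{n-1}^{n-2}\cdots X_2 \pmod{(e_1,\dots,e_n)R}$;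 in particular, $\Delta\in(e_1,\dots,e_n)R$ if $p$ divides $n!$. -/

import Mathlib

open MvPolynomial

/-- The Frobenius power `I^[q]`: the ideal generated by the `q`-th powers of the elements of `I`.
When `q` is a power of the characteristic of the ring, it is generated by the `q`-th powers of
any set of generators of `I`. -/
def frobeniusPower {R : Type*} [CommRing R] (I : Ideal R) (q : ℕ) : Ideal R :=
  Ideal.span ((fun x : R => x ^ q) '' (I : Set R))

/-- The set `R°`, the complement of the union of the minimal primes of `R`. -/
def minimalPrimesCompl (R : Type*) [CommRing R] : Set R :=
  (⋃ P ∈ minimalPrimes R, (P : Set R))ᶜ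

/-- The tight closure `I^*` of an ideal `I` of a ring `R` of characteristic `p`: the elements `x`
for which some `c ∈ R°` satisfies `c * x ^ q ∈ I^[q]` for all large powers `q = p ^ e`. -/
def tightClosure {R : Type*} [CommRing R] (p : ℕ) (I : Ideal R) : Set R :=
  {x | ∃ c ∈ minimalPrimesCompl R, ∃ e₀ : ℕ, ∀ e : ℕ, e₀ ≤ e →
    c * x ^ (p ^ e) ∈ frobeniusPower I (p ^ e)}

/-- A ring (Noetherian, of characteristic `p`) is weakly F-regular if every ideal is equal to its
tight closure. -/
def IsWeaklyFRegular (p : ℕ) (R : Type*) [CommRing R] : Prop :=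
  ∀ I : Ideal R, tightClosure p I = (I : Set R)

/-- A ring (Noetherian, of characteristic `p`) is F-regular if every localization (at an arbitrary
multiplicative set) is weakly F-regular. -/
def IsFRegular (p : ℕ) (R : Type*) [CommRing R] : Prop :=
  ∀ W : Submonoid R, IsWeaklyFRegular p (Localization W)

/-- `S` (that is, its image in the `S`-algebra `R`) is a direct summand of `R` as an
`S`-module. -/
def IsDirectSummandOf (S R : Type*) [CommRing S] [CommRing R] [Algebra S R] : Prop :=
  ∃ N : Submodule S R, IsCompl (LinearMap.range (Algebra.linearMap S R)) N

/-- The subring of `K[X_1, …, X_n]` of invariants of the alternating group `A_n`, which acts by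
permuting the variables. -/
def alternatingInvariants (K : Type*) [Field K] (n : ℕ) :
    Subalgebra K (MvPolynomial (Fin n) K) where
  carrier := {f | ∀ σ ∈ alternatingGroup (Fin n), rename σ f = f}
  algebraMap_mem' r σ _ := by simp [algebraMap_eq]
  mul_mem' hf hg σ hσ := by rw [map_mul, hf σ hσ, hg σ hσ]
  add_mem' hf hg σ hσ := by rw [map_add, hf σ hσ, hg σ hσ]

/-- `Δ = ∏_{i > j} (X_i - X_j)`. -/
noncomputable def alternatingDelta (K : Type*) [Field K] (n : ℕ) : MvPolynomial (Fin n) K :=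
  ∏ i : Fin n, ∏ j ∈ Finset.Iio i, (X i - X j)

/-- The ideal `(e_1, …, e_n)` of `K[X_1, …, X_n]`. -/
noncomputable def esymmIdeal (K : Type*) [Field K] (n : ℕ) : Ideal (MvPolynomial (Fin n) K) :=
  Ideal.span (Set.range fun i : Fin n => esymm (Fin n) K ((i : ℕ) + 1))

/-! Write `S` for the invariant ring, `E` for its ideal `(e_1, …, e_n)`, and `τ` for a
transposition. For `f` in `S`, `f + τf` is symmetric and `f - τf` is alternating, hence `Δ` times a
symmetric polynomial; halving the sum gives the generators of `S`. If `p ∤ n!/2`, the trace divided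
by `n!/2` is an `S`-linear retraction `R → S`. Frobenius splittings of `R` descend along it, and
they force F-regularity (`HasFrobeniusSplittings.isFRegular`). If `p ∣ n!/2`, the congruence for `Δ`
gives `Δ ∈ ER`, while `Δ ∉ E` (`alternatingDelta_notMem_alternatingEsymmIdeal`). A retraction would
put `Δ` in `E`, so `S` is not a direct summand. The trace is still nonzero, which puts `Δ` in the
tight closure of `E`, so `S` is not F-regular. -/

/-! ### Frobenius powers and tight closure -/

section FrobeniusPower

variable {R S : Type*} [CommRing R] [CommRing S]

theorem pow_mem_frobeniusPower {I : Ideal R} {x : R} (hx : x ∈ I) (q : ℕ) :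
    x ^ q ∈ frobeniusPower I q :=
  Ideal.subset_span ⟨x, hx, rfl⟩

theorem map_mem_frobeniusPower_map (f : R →+* S) {I : Ideal R} {q : ℕ} {x : R}
    (hx : x ∈ frobeniusPower I q) : f x ∈ frobeniusPower (I.map f) q := by
  have h : frobeniusPower I q ≤ (frobeniusPower (I.map f) q).comap f := by
    refine Ideal.span_le.2 ?_
    rintro _ ⟨y, hy, rfl⟩
    simpa using pow_mem_frobeniusPower (Ideal.mem_map_of_mem f hy) q
  exact h hx

theorem pow_mem_map_frobeniusPower (f : R →+* S) (p : ℕ) [ExpChar S p] {I : Ideal R} (e : ℕ)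
    {x : S} (hx : x ∈ I.map f) : x ^ p ^ e ∈ (frobeniusPower I (p ^ e)).map f := by
  induction hx using Submodule.span_induction with
  | mem x h =>
    obtain ⟨y, hy, rfl⟩ := h
    rw [← map_pow]
    exact Ideal.mem_map_of_mem f (pow_mem_frobeniusPower hy _)
  | zero =>
    rw [zero_pow (pow_ne_zero _ (expChar_pos S p).ne')]
    exact Ideal.zero_mem _
  | add x y _ _ hx hy =>
    rw [add_pow_expChar_pow]
    exact Ideal.add_mem _ hx hy
  | smul a x _ hx =>
    rw [smul_eq_mul, mul_pow]
    exact Ideal.mul_mem_left _ _ hx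

theorem mem_minimalPrimesCompl [IsDomain R] {c : R} : c ∈ minimalPrimesCompl R ↔ c ≠ 0 := by
  simp [minimalPrimesCompl, IsDomain.minimalPrimes_eq_singleton_bot]

theorem subset_tightClosure (p : ℕ) (I : Ideal R) : (I : Set R) ⊆ tightClosure p I := by
  intro x hx
  refine ⟨1, ?_, 0, fun e _ => ?_⟩
  · simp only [minimalPrimesCompl, Set.mem_compl_iff, Set.mem_iUnion, not_exists]
    intro P hP h
    exact hP.1.1.ne_top ((Ideal.eq_top_iff_one P).2 h)
  · rw [one_mul]
    exact pow_mem_frobeniusPower hx _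

theorem LinearMap.apply_mul_mem_of_mem_map [Algebra S R] (h : R →ₗ[S] S) {J : Ideal S} {x : R}
    (hx : x ∈ J.map (algebraMap S R)) (g : R) : h (g * x) ∈ J := by
  induction hx using Submodule.span_induction generalizing g with
  | mem x hx =>
    obtain ⟨y, hy, rfl⟩ := hx
    rw [mul_comm, ← Algebra.smul_def, map_smul]
    exact J.mul_mem_right _ hy
  | zero => simp
  | add x y _ _ hx hy =>
    rw [mul_add, map_add]
    exact J.add_mem (hx g) (hy g)
  | smul a x _ hx =>
    rw [smul_eq_mul, ← mul_assoc]
    exact hx (g * a)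

/-- If some `S`-linear map `R → S` is nonzero, contractions of extended ideals lie in the tight
closure. -/
theorem mem_tightClosure_of_mem_map [IsDomain S] [Algebra S R] (p : ℕ) [ExpChar R p]
    (h : R →ₗ[S] S) {g : R} (hg : h g ≠ 0) {I : Ideal S} {x : S}
    (hx : algebraMap S R x ∈ I.map (algebraMap S R)) : x ∈ tightClosure p I := by
  -- Applying `h` to `g * x ^ q`, which lies in the extension of `I^[q]`, gives `h g * x ^ q ∈
  -- I^[q]`.
  refine ⟨h g, mem_minimalPrimesCompl.2 hg, 0, fun e _ => ?_⟩
  have := h.apply_mul_mem_of_mem_map (pow_mem_map_frobeniusPower _ p e hx) g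
  rwa [← map_pow, mul_comm, ← Algebra.smul_def, map_smul, smul_eq_mul, mul_comm] at this

theorem IsFRegular.mem_of_mem_tightClosure [IsDomain R] {p : ℕ} (h : IsFRegular p R) {I : Ideal R}
    {x : R} (hx : x ∈ tightClosure p I) : x ∈ I := by
  obtain ⟨c, hc, e₀, H⟩ := hx
  -- Localizing at the trivial submonoid recovers `R` itself.
  have hW : (⊥ : Submonoid R) ≤ nonZeroDivisors R := bot_le
  have : IsDomain (Localization (⊥ : Submonoid R)) := IsLocalization.isDomain_localization hW
  have hmem : algebraMap R (Localization (⊥ : Submonoid R)) x ∈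
      tightClosure p (I.map (algebraMap R (Localization (⊥ : Submonoid R)))) := by
    refine ⟨algebraMap _ _ c, mem_minimalPrimesCompl.2 ?_, e₀, fun e he => ?_⟩
    · rw [Ne, FaithfulSMul.algebraMap_eq_zero_iff]
      exact mem_minimalPrimesCompl.1 hc
    · simpa using map_mem_frobeniusPower_map (algebraMap R (Localization (⊥ : Submonoid R))) (H e he)
  rw [h ⊥] at hmem
  obtain ⟨m, hm, hmx⟩ := (IsLocalization.algebraMap_mem_map_algebraMap_iff ⊥ _ I x).1 hmem
  rw [Submonoid.mem_bot] at hm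
  simpa [hm] using hmx

end FrobeniusPower

/-! ### Frobenius splittings and F-regularity -/

/-- A strong form of F-regularity: every nonzero `c` is sent to `1` by a `p ^ (-e)`-linear
endomorphism, for all large `e`. -/
def HasFrobeniusSplittings (p : ℕ) (R : Type*) [CommRing R] : Prop :=
  ∀ c : R, c ≠ 0 → ∃ e₀ : ℕ, ∀ e : ℕ, e₀ ≤ e →
    ∃ ψ : R →+ R, (∀ r s, ψ (r ^ p ^ e * s) = r * ψ s) ∧ ψ c = 1

section Splittings

variable {R S : Type*} [CommRing R] [CommRing S]

theorem AddMonoidHom.apply_mem_of_mem_frobeniusPower {I : Ideal R} {q : ℕ} (ψ : R →+ R)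
    (hψ : ∀ r s, ψ (r ^ q * s) = r * ψ s) {x : R} (hx : x ∈ frobeniusPower I q) : ψ x ∈ I := by
  suffices ∀ s, ψ (s * x) ∈ I by simpa using this 1
  induction hx using Submodule.span_induction with
  | mem x hx =>
    obtain ⟨y, hy, rfl⟩ := hx
    intro s
    rw [mul_comm, hψ]
    exact I.mul_mem_right _ hy
  | zero => simp
  | add x y _ _ hx hy =>
    intro s
    rw [mul_add, map_add]
    exact I.add_mem (hx s) (hy s)
  | smul a x _ hx =>
    intro s
    rw [smul_eq_mul, ← mul_assoc]
    exact hx (s * a)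

theorem frobeniusPower_le_map_comap (W : Submonoid R) (I : Ideal (Localization W)) (q : ℕ) :
    frobeniusPower I q ≤
      (frobeniusPower (I.comap (algebraMap R _)) q).map (algebraMap R (Localization W)) := by
  refine Ideal.span_le.2 ?_
  rintro _ ⟨y, hy, rfl⟩
  obtain ⟨b, v, rfl⟩ := IsLocalization.exists_mk'_eq W y
  have hb : b ∈ I.comap (algebraMap R (Localization W)) := by
    rw [Ideal.mem_comap, ← IsLocalization.mk'_spec' (Localization W) b v]
    exact I.mul_mem_left _ hy
  simp only [SetLike.mem_coe, ← IsLocalization.mk'_pow]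
  rw [IsLocalization.mk'_mem_map_algebraMap_iff]
  exact ⟨1, W.one_mem, by simpa using pow_mem_frobeniusPower hb q⟩

/-- If `c * x ^ q ∈ I^[q]`, a splitting `ψ` with `ψ c = 1` sends it to `x ∈ I`. Clearing
denominators reduces localizations to this computation in `R`. -/
theorem HasFrobeniusSplittings.isFRegular [IsDomain R] {p : ℕ} (hp : p ≠ 0)
    (h : HasFrobeniusSplittings p R) : IsFRegular p R := by
  intro W I
  refine Set.Subset.antisymm ?_ (subset_tightClosure p I)
  by_cases hW : (0 : R) ∈ W
  · have := IsLocalization.subsingleton (M := W) (S := Localization W) hW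
    intro x _
    rw [Subsingleton.elim x 0]
    exact I.zero_mem
  have hW' : W ≤ nonZeroDivisors R :=
    le_nonZeroDivisors_of_noZeroDivisors hW
  have : IsDomain (Localization W) := IsLocalization.isDomain_localization hW'
  rintro x ⟨c, hc, e₀, H⟩
  rw [mem_minimalPrimesCompl] at hc
  obtain ⟨a, w, rfl⟩ := IsLocalization.exists_mk'_eq W x
  obtain ⟨c, v, rfl⟩ := IsLocalization.exists_mk'_eq W c
  have hc' : c ≠ 0 := by
    rintro rfl
    simp at hc
  obtain ⟨e₁, he₁⟩ := h c hc'
  obtain ⟨ψ, hψ, hψc⟩ := he₁ (max e₀ e₁) (le_max_right _ _)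
  have hx := frobeniusPower_le_map_comap W I _ (H (max e₀ e₁) (le_max_left _ _))
  set q := p ^ max e₀ e₁ with hq
  have hq0 : q ≠ 0 := pow_ne_zero _ hp
  rw [← IsLocalization.mk'_pow, ← IsLocalization.mk'_mul,
    IsLocalization.mk'_mem_map_algebraMap_iff] at hx
  obtain ⟨u, hu, hux⟩ := hx
  -- The denominator `u` is raised to a full `q`-th power so that it can leave `ψ`.
  have hmem : (u * a) ^ q * c ∈ frobeniusPower (I.comap (algebraMap R (Localization W))) q := by
    have : (u * a) ^ q * c = u ^ (q - 1) * (u * (c * a ^ q)) := by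
      obtain ⟨k, hk⟩ := Nat.exists_eq_succ_of_ne_zero hq0
      rw [hk, Nat.succ_eq_add_one, Nat.add_sub_cancel]
      ring
    rw [this]
    exact Ideal.mul_mem_left _ _ hux
  have hI := ψ.apply_mem_of_mem_frobeniusPower hψ hmem
  rw [hψ, hψc, mul_one, Ideal.mem_comap, map_mul,
    Ideal.unit_mul_mem_iff_mem _ (IsLocalization.map_units (Localization W) ⟨u, hu⟩)] at hI
  rw [SetLike.mem_coe, IsLocalization.mk'_eq_mul_mk'_one]
  exact I.mul_mem_right _ hI

theorem HasFrobeniusSplittings.of_retraction [Algebra S R] [FaithfulSMul S R] {p : ℕ}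
    (h : HasFrobeniusSplittings p R) (f : R →ₗ[S] S) (hf : f 1 = 1) :
    HasFrobeniusSplittings p S := by
  intro c hc
  obtain ⟨e₀, H⟩ := h (algebraMap S R c) (by rwa [Ne, FaithfulSMul.algebraMap_eq_zero_iff])
  refine ⟨e₀, fun e he => ?_⟩
  obtain ⟨ψ, hψ, hψc⟩ := H e he
  refine ⟨(f.toAddMonoidHom.comp ψ).comp (algebraMap S R).toAddMonoidHom, fun r s => ?_, ?_⟩
  · simp [hψ, ← Algebra.smul_def]
  · simp [hψc, hf]

theorem isDirectSummandOf_iff [Algebra S R] [FaithfulSMul S R] :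
    IsDirectSummandOf S R ↔ ∃ f : R →ₗ[S] S, f 1 = 1 := by
  constructor
  · rintro ⟨N, hN⟩
    have hinj : Function.Injective (Algebra.linearMap S R) := FaithfulSMul.algebraMap_injective S R
    refine ⟨(LinearEquiv.ofInjective _ hinj).symm.toLinearMap ∘ₗ
      Submodule.projectionOnto _ N hN, ?_⟩
    have h1 : (1 : R) = ((LinearEquiv.ofInjective _ hinj 1 : LinearMap.range _) : R) := by simp
    rw [LinearMap.comp_apply, h1, Submodule.projectionOnto_apply_left]
    simp
  · rintro ⟨f, hf⟩
    have hproj : LinearMap.IsProj (LinearMap.range (Algebra.linearMap S R))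
        (Algebra.linearMap S R ∘ₗ f) := by
      refine ⟨fun x => ⟨f x, rfl⟩, ?_⟩
      rintro _ ⟨s, rfl⟩
      simp [Algebra.algebraMap_eq_smul_one, hf]
    exact ⟨_, hproj.isCompl⟩

end Splittings

/-! ### Frobenius splittings of the polynomial ring -/

/-- Applied to iterated Frobenius, this replaces `q`-th roots of coefficients, as `K` need not be
perfect. -/
theorem RingHom.exists_addMonoidHom_map_mul_eq {F K : Type*} [Field F] [Field K] (f : F →+* K)
    {c : K} (hc : c ≠ 0) : ∃ φ : K →+ F, (∀ r s, φ (f r * s) = r * φ s) ∧ φ c = 1 := by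
  let := f.toAlgebra
  obtain ⟨φ, hφ⟩ := Module.Projective.exists_dual_eq_one F hc
  exact ⟨φ.toAddMonoidHom, fun r s => φ.map_smul r s, hφ⟩

namespace MvPolynomial

variable {σ K : Type*} [Field K]

/-- The additive endomorphism of `K[X]` whose `k`-th coefficient is `φ` applied to the coefficient
at `q * k + a`. -/
noncomputable def sectionMap (φ : K →+ K) {q : ℕ} (hq : q ≠ 0) (a : σ →₀ ℕ) :
    MvPolynomial σ K →+ MvPolynomial σ K where
  toFun f := .ofCoeff (((Finsupp.comapDomain (fun k : σ →₀ ℕ => q • k + a)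
    (AddMonoidAlgebra.coeff f)
    (fun x _ y _ h => by
      ext i
      have := DFunLike.congr_fun h i
      simpa [hq] using this)).mapRange φ φ.map_zero))
  map_zero' := by
    ext k
    simp [coeff]
  map_add' f g := by
    ext k
    exact map_add φ (coeff (q • k + a) f) (coeff (q • k + a) g)

theorem coeff_sectionMap (φ : K →+ K) {q : ℕ} (hq : q ≠ 0) (a k : σ →₀ ℕ)
    (f : MvPolynomial σ K) : coeff k (sectionMap φ hq a f) = φ (coeff (q • k + a) f) := rfl

/-- Frobenius is additive, so `f` may be a monomial; `a i < q` makes `q • m ≤ q • k + a` equivalent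
to `m ≤ k`. -/
theorem sectionMap_pow_mul (φ : K →+ K) (p : ℕ) [ExpChar K p] (e : ℕ) (hq : p ^ e ≠ 0)
    (hφ : ∀ r s, φ (r ^ p ^ e * s) = r * φ s) {a : σ →₀ ℕ} (ha : ∀ i, a i < p ^ e)
    (f g : MvPolynomial σ K) :
    sectionMap φ hq a (f ^ p ^ e * g) = f * sectionMap φ hq a g := by
  induction f using MvPolynomial.induction_on' with
  | add f₁ f₂ h₁ h₂ => rw [add_pow_expChar_pow, add_mul, map_add, h₁, h₂, add_mul]
  | monomial m t =>
    ext k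
    rw [monomial_pow, coeff_sectionMap, coeff_monomial_mul', coeff_monomial_mul']
    have key : p ^ e • m ≤ p ^ e • k + a ↔ m ≤ k := by
      refine forall_congr' fun i => ?_
      simp only [Finsupp.smul_apply, Finsupp.add_apply, smul_eq_mul]
      refine ⟨fun h => ?_, fun h => le_add_right (Nat.mul_le_mul_left _ h)⟩
      have := ha i
      by_contra! hlt
      have := Nat.mul_le_mul_left (p ^ e) (Nat.succ_le_of_lt hlt)
      rw [Nat.succ_eq_add_one, mul_add] at this
      lia
    rw [if_congr key rfl rfl]
    split_ifs with h
    · rw [hφ, coeff_sectionMap]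
      congr 3
      ext i
      simp only [Finsupp.smul_apply, Finsupp.add_apply, Finsupp.tsub_apply, smul_eq_mul,
        Nat.mul_sub]
      have := Nat.mul_le_mul_left (p ^ e) (h i)
      lia
    · exact map_zero φ

theorem hasFrobeniusSplittings (p : ℕ) [Fact p.Prime] [CharP K p] :
    HasFrobeniusSplittings p (MvPolynomial σ K) := by
  intro c hc
  classical
  have hp := (Fact.out : p.Prime)
  -- Now `p ^ e` exceeds every exponent in `c`, so among the exponents `q • k + a` only `k = 0`
  -- meets the support of `c`.
  refine ⟨c.totalDegree, fun e he => ?_⟩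
  have hdeg : c.totalDegree < p ^ e := he.trans_lt (Nat.lt_pow_self hp.one_lt)
  obtain ⟨a, ha⟩ := ne_zero_iff.1 hc
  obtain ⟨φ, hφ, hφa⟩ := (iterateFrobenius K p e).exists_addMonoidHom_map_mul_eq ha
  have hlt : ∀ b, coeff b c ≠ 0 → ∀ i, b i < p ^ e := fun b hb i =>
    ((monomial_le_degreeOf i (mem_support_iff.2 hb)).trans (degreeOf_le_totalDegree c i)).trans_lt
      hdeg
  have hq : p ^ e ≠ 0 := pow_ne_zero _ hp.ne_zero
  refine ⟨sectionMap φ hq a, sectionMap_pow_mul φ p e hq hφ (hlt a ha), ?_⟩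
  ext k
  rw [coeff_sectionMap, coeff_one]
  split_ifs with hk
  · rw [← hk, smul_zero, zero_add, hφa]
  · obtain ⟨i, hi⟩ : ∃ i, k i ≠ 0 := by
      by_contra! h
      exact hk (Finsupp.ext fun i => (h i).symm)
    rw [not_imp_comm.1 (hlt (p ^ e • k + a)), map_zero]
    intro h
    have := h i
    simp only [Finsupp.smul_apply, Finsupp.add_apply, smul_eq_mul] at this
    have := Nat.mul_le_mul_left (p ^ e) (Nat.one_le_iff_ne_zero.2 hi)
    lia

end MvPolynomial

/-! ### The Vandermonde product when all elementary symmetric functions vanish -/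

/-- If `∏ (T - x i) = T ^ n`, then the Vandermonde product of the `x i` is `n! ∏ x i ^ i`. -/
theorem prod_prod_Iio_sub_of_prod_X_sub_C_eq {A : Type*} [CommRing A] {n : ℕ} (x : Fin n → A)
    (hx : ∏ i, (Polynomial.X - Polynomial.C (x i)) = Polynomial.X ^ n) :
    ∏ i, ∏ j ∈ Finset.Iio i, (x i - x j) = n.factorial * ∏ i, x i ^ (i : ℕ) := by
  induction n generalizing A with
  | zero => simp
  | succ n ih =>
    set y := x (Fin.last n) with hy
    rw [Fin.prod_univ_castSucc, ← hy] at hx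
    have hy0 : y ^ (n + 1) = 0 := by
      have := congrArg (Polynomial.eval y) hx
      simpa using this.symm
    -- Differentiate the hypothesis and evaluate at the root `y`.
    have hder : ∏ j : Fin n, (y - x j.castSucc) = (n + 1) * y ^ n := by
      have := congrArg (fun f => Polynomial.eval y (Polynomial.derivative f)) hx
      simpa [Polynomial.derivative_mul, Polynomial.eval_prod] using this
    let π := Ideal.Quotient.mk (Ideal.span {y})
    have hπy : π y = 0 := Ideal.Quotient.eq_zero_iff_mem.2 (Ideal.mem_span_singleton_self y)
    -- Modulo `y` one factor `T` cancels. Induction then gives the formula up to a multiple of `y`,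
    -- which the last factor `(n + 1) * y ^ n` kills.
    have hbar : ∏ i : Fin n, (Polynomial.X - Polynomial.C (π (x i.castSucc))) =
        Polynomial.X ^ n := by
      have := congrArg (Polynomial.map π) hx
      simp only [Polynomial.map_mul, Polynomial.map_prod, Polynomial.map_sub, Polynomial.map_X,
        Polynomial.map_C, Polynomial.map_pow, hπy, map_zero, sub_zero, pow_succ] at this
      ext k
      have := congrArg (fun f => Polynomial.coeff f (k + 1)) this
      simpa only [Polynomial.coeff_mul_X] using this
    have h := ih (fun i => π (x i.castSucc)) hbar
    simp only [← map_sub, ← map_prod, ← map_pow, ← map_natCast π, ← map_mul] at h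
    obtain ⟨z, hz⟩ := Ideal.mem_span_singleton'.1 (Ideal.Quotient.eq.1 h)
    rw [Fin.prod_univ_castSucc, Fin.prod_univ_castSucc]
    have hlast : ∏ j ∈ Finset.Iio (Fin.last n), (x (Fin.last n) - x j) = (n + 1) * y ^ n := by
      rw [← hder, Fin.Iio_last_eq_map, Finset.prod_map]
      rfl
    have hcast : ∀ i : Fin n, ∏ j ∈ Finset.Iio i.castSucc, (x i.castSucc - x j) =
        ∏ j ∈ Finset.Iio i, (x i.castSucc - x j.castSucc) := by
      intro i
      rw [← Fin.map_castSuccEmb_Iio, Finset.prod_map]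
      rfl
    simp only [hlast, hcast, Fin.val_castSucc, Fin.val_last]
    rw [sub_eq_iff_eq_add.1 hz.symm, Nat.factorial_succ, ← hy]
    push_cast
    linear_combination (z * (n + 1)) * hy0

/-! ### Divisibility by differences of variables -/

namespace MvPolynomial

section Divisibility

variable {σ K : Type*} [Field K]

theorem irreducible_X_sub_X {i j : σ} (hij : i ≠ j) :
    Irreducible (X i - X j : MvPolynomial σ K) := by
  have := irreducible_mul_X_add (1 : MvPolynomial σ K) (-X j) i one_ne_zero (by simp)
    (by simpa [vars_neg] using hij) isRelPrime_one_left
  rwa [one_mul, ← sub_eq_add_neg] at this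

variable [DecidableEq σ]

theorem X_sub_X_dvd_sub_aeval (i j : σ) (f : MvPolynomial σ K) :
    X i - X j ∣ f - aeval (Function.update X i (X j) : σ → MvPolynomial σ K) f := by
  rw [← Ideal.mem_span_singleton, ← Ideal.Quotient.eq]
  have h : (Ideal.Quotient.mkₐ K (Ideal.span {(X i - X j : MvPolynomial σ K)})) =
      (Ideal.Quotient.mkₐ K _).comp
        (aeval (Function.update X i (X j)) : MvPolynomial σ K →ₐ[K] MvPolynomial σ K) := by
    ext k
    by_cases hk : k = i
    · subst hk
      simpa using Ideal.Quotient.eq.2 (Ideal.mem_span_singleton_self _)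
    · simp [hk]
  exact DFunLike.congr_fun h f

/-- The substitution `X i ↦ X j` does not see the swap, so the value of `f` equals its own negative
and vanishes. -/
theorem X_sub_X_dvd_of_rename_swap (h2 : (2 : K) ≠ 0) (i j : σ) {f : MvPolynomial σ K}
    (hf : rename (Equiv.swap i j) f = -f) : (X i - X j : MvPolynomial σ K) ∣ f := by
  have hcomp : (aeval (Function.update X i (X j)) : MvPolynomial σ K →ₐ[K]
      MvPolynomial σ K).comp (rename (Equiv.swap i j)) = aeval (Function.update X i (X j)) := by
    ext k
    by_cases hki : k = i
    · subst hki
      by_cases hkj : j = k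
      · simp [hkj]
      · simp [hkj]
    by_cases hkj : k = j
    · subst hkj
      simp [hki]
    · simp [hki, Equiv.swap_apply_of_ne_of_ne hki hkj]
  have h := DFunLike.congr_fun hcomp f
  rw [AlgHom.comp_apply, hf, map_neg] at h
  have h2' : (2 : MvPolynomial σ K) ≠ 0 := by
    rw [← map_ofNat C 2, Ne, C_eq_zero]
    exact h2
  have h0 : aeval (Function.update X i (X j)) f = 0 :=
    (mul_eq_zero.1 (by linear_combination -h :
      (2 : MvPolynomial σ K) * aeval (Function.update X i (X j)) f = 0)).resolve_left h2'
  have hdvd := X_sub_X_dvd_sub_aeval i j f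
  rwa [h0, sub_zero] at hdvd

theorem isRelPrime_X_sub_X [LinearOrder σ] {i j k l : σ} (hij : j < i) (hkl : l < k)
    (h : ¬ (i = k ∧ j = l)) : IsRelPrime (X i - X j : MvPolynomial σ K) (X k - X l) := by
  rw [(irreducible_X_sub_X hij.ne').isRelPrime_iff_not_dvd]
  rintro ⟨g, hg⟩
  have := congrArg (aeval (Function.update X i (X j)) : MvPolynomial σ K →ₐ[K] MvPolynomial σ K) hg
  simp only [map_sub, map_mul, aeval_X, Function.update_self, Function.update_of_ne hij.ne,
    sub_self, zero_mul, sub_eq_zero, Function.update_apply] at this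
  split_ifs at this with h1 h2 h2
  · exact hkl.ne (h2.trans h1.symm)
  · exact h ⟨h1.symm, X_injective this⟩
  · have := X_injective this
    exact absurd (hij.trans (h2 ▸ hkl)) (this ▸ lt_irrefl _)
  · exact hkl.ne' (X_injective this)

end Divisibility

end MvPolynomial

/-! ### Generators of the invariant ring, and `Δ` modulo the `e_i` -/

section Alternating

variable {K : Type*} [Field K] {n : ℕ}

theorem alternatingDelta_dvd (h2 : (2 : K) ≠ 0) {f : MvPolynomial (Fin n) K}
    (hf : ∀ i j : Fin n, i ≠ j → rename (Equiv.swap i j) f = -f) : alternatingDelta K n ∣ f := by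
  rw [alternatingDelta, Finset.prod_sigma']
  refine Finset.prod_dvd_of_isRelPrime ?_ ?_
  · rintro ⟨i, j⟩ h ⟨k, l⟩ h' hne
    simp only [Finset.coe_sigma, Set.mem_sigma_iff, Finset.coe_Iio, Set.mem_Iio] at h h'
    refine isRelPrime_X_sub_X h.2 h'.2 ?_
    rintro ⟨rfl, rfl⟩
    exact hne rfl
  · rintro ⟨i, j⟩ h
    simp only [Finset.mem_sigma, Finset.mem_Iio] at h
    exact X_sub_X_dvd_of_rename_swap h2 i j (hf i j h.2.ne')

theorem rename_alternatingDelta (σ : Equiv.Perm (Fin n)) :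
    rename σ (alternatingDelta K n) = (Equiv.Perm.sign σ : ℤ) * alternatingDelta K n := by
  simp only [alternatingDelta, map_prod, map_sub, rename_X]
  exact σ.prod_Iio_comp_eq_sign_mul_prod
    (f := fun j i => (X i - X j : MvPolynomial (Fin n) K)) fun i j => by ring

theorem alternatingDelta_ne_zero : alternatingDelta K n ≠ 0 := by
  refine Finset.prod_ne_zero_iff.2 fun i _ => Finset.prod_ne_zero_iff.2 fun j hj => ?_
  rw [sub_ne_zero, Ne, X_injective.eq_iff]
  exact (Finset.mem_Iio.1 hj).ne'

theorem alternatingDelta_mem : alternatingDelta K n ∈ alternatingInvariants K n := by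
  intro σ hσ
  rw [rename_alternatingDelta, Equiv.Perm.mem_alternatingGroup.1 hσ]
  simp

theorem MvPolynomial.IsSymmetric.mem_alternatingInvariants {f : MvPolynomial (Fin n) K}
    (hf : f.IsSymmetric) : f ∈ alternatingInvariants K n := fun σ _ => hf σ

theorem rename_eq_of_sign_eq {f : MvPolynomial (Fin n) K} (hf : f ∈ alternatingInvariants K n)
    {σ τ : Equiv.Perm (Fin n)} (h : Equiv.Perm.sign σ = Equiv.Perm.sign τ) :
    rename σ f = rename τ f := by
  have := hf (τ⁻¹ * σ) (Equiv.Perm.mem_alternatingGroup.2 (by simp [h]))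
  conv_rhs => rw [← this, rename_rename]
  congr 2
  ext
  simp

/-- A permutation multiplies both the difference and `Δ` by its sign, so `Δ` divides the difference
and the quotient is symmetric. -/
theorem sub_rename_swap_eq_mul (h2 : (2 : K) ≠ 0) {f : MvPolynomial (Fin n) K}
    (hf : f ∈ alternatingInvariants K n) {i j : Fin n} (hij : i ≠ j) :
    ∃ g : MvPolynomial (Fin n) K, g.IsSymmetric ∧
      f - rename (Equiv.swap i j) f = alternatingDelta K n * g := by
  have key : ∀ σ : Equiv.Perm (Fin n), rename σ (f - rename (Equiv.swap i j) f) =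
      (Equiv.Perm.sign σ : ℤ) * (f - rename (Equiv.swap i j) f) := by
    intro σ
    have hmul : rename σ (rename (Equiv.swap i j) f) =
        rename (σ * Equiv.swap i j : Equiv.Perm _) f := by
      rw [rename_rename]
      rfl
    rw [map_sub, hmul]
    rcases Int.units_eq_one_or (Equiv.Perm.sign σ) with h | h
    · rw [hf σ h, rename_eq_of_sign_eq hf (τ := Equiv.swap i j) (by simp [h]), h]
      simp
    · rw [rename_eq_of_sign_eq hf (σ := σ) (τ := Equiv.swap i j)
        (by rw [h, Equiv.Perm.sign_swap hij]),
        hf (σ * Equiv.swap i j) (Equiv.Perm.mem_alternatingGroup.2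
          (by simp [h, Equiv.Perm.sign_swap hij])), h]
      simp
  obtain ⟨g, hg⟩ := alternatingDelta_dvd h2 (f := f - rename (Equiv.swap i j) f)
    fun k l hkl => by rw [key, Equiv.Perm.sign_swap hkl]; simp
  refine ⟨g, fun σ => ?_, hg⟩
  have := key σ
  rw [hg, map_mul, rename_alternatingDelta, mul_assoc] at this
  have hs : ((Equiv.Perm.sign σ : ℤ) : MvPolynomial (Fin n) K) ≠ 0 := by
    rcases Int.units_eq_one_or (Equiv.Perm.sign σ) with h | h <;> simp [h]
  exact mul_left_cancel₀ alternatingDelta_ne_zero (mul_left_cancel₀ hs this)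

theorem add_rename_swap_isSymmetric {f : MvPolynomial (Fin n) K}
    (hf : f ∈ alternatingInvariants K n) {i j : Fin n} (hij : i ≠ j) :
    (f + rename (Equiv.swap i j) f).IsSymmetric := by
  intro σ
  have hmul : rename σ (rename (Equiv.swap i j) f) =
      rename (σ * Equiv.swap i j : Equiv.Perm _) f := by
    rw [rename_rename]
    rfl
  rw [map_add, hmul]
  rcases Int.units_eq_one_or (Equiv.Perm.sign σ) with h | h
  · rw [hf σ h, rename_eq_of_sign_eq hf (τ := Equiv.swap i j) (by simp [h])]
  · rw [rename_eq_of_sign_eq hf (σ := σ) (τ := Equiv.swap i j)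
      (by rw [h, Equiv.Perm.sign_swap hij]),
      hf (σ * Equiv.swap i j) (Equiv.Perm.mem_alternatingGroup.2
        (by simp [h, Equiv.Perm.sign_swap hij])), add_comm]

theorem MvPolynomial.IsSymmetric.mem_adjoin_esymm {f : MvPolynomial (Fin n) K}
    (hf : f.IsSymmetric) :
    f ∈ Algebra.adjoin K (Set.range fun i : Fin n => esymm (Fin n) K ((i : ℕ) + 1)) := by
  obtain ⟨g, hg⟩ := esymmAlgHom_surjective (σ := Fin n) (n := n) K (by simp) ⟨f, hf⟩
  rw [Algebra.adjoin_range_eq_range_aeval]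
  exact ⟨g, (esymmAlgHom_apply g).symm.trans (congrArg Subtype.val hg)⟩

theorem alternatingInvariants_eq_adjoin (h2 : (2 : K) ≠ 0) (hn : 2 ≤ n) :
    alternatingInvariants K n =
      Algebra.adjoin K ((Set.range fun i : Fin n => esymm (Fin n) K ((i : ℕ) + 1)) ∪
        {alternatingDelta K n}) := by
  refine le_antisymm (fun f hf => ?_) (Algebra.adjoin_le ?_)
  · have : Fact (2 ≤ n) := ⟨hn⟩
    have : Nontrivial (Fin n) := Fin.nontrivial_iff_two_le.2 hn
    obtain ⟨i, j, hij⟩ := exists_pair_ne (Fin n)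
    obtain ⟨g, hg, hfg⟩ := sub_rename_swap_eq_mul h2 hf hij
    have hsymm := Algebra.adjoin_mono (Set.subset_union_left (t := {alternatingDelta K n}))
      (add_rename_swap_isSymmetric hf hij).mem_adjoin_esymm
    have hg' := Algebra.adjoin_mono (Set.subset_union_left (t := {alternatingDelta K n}))
      hg.mem_adjoin_esymm
    have hΔ : alternatingDelta K n ∈ Algebra.adjoin K ((Set.range fun i : Fin n =>
        esymm (Fin n) K ((i : ℕ) + 1)) ∪ {alternatingDelta K n}) :=
      Algebra.subset_adjoin (Or.inr rfl)
    have h := Subalgebra.smul_mem _ (add_mem hsymm (hfg ▸ mul_mem hΔ hg')) (2⁻¹ : K)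
    have hf2 : (2⁻¹ : K) • (f + rename (Equiv.swap i j) f + (f - rename (Equiv.swap i j) f)) = f := by
      rw [add_add_sub_cancel, ← two_smul K f, smul_smul, inv_mul_cancel₀ h2, one_smul]
    rwa [hf2] at h
  · rintro _ (⟨i, rfl⟩ | rfl)
    · exact (esymm_isSymmetric (Fin n) K _).mem_alternatingInvariants
    · exact alternatingDelta_mem

theorem alternatingDelta_sub_mem_esymmIdeal :
    alternatingDelta K n - (n.factorial : MvPolynomial (Fin n) K) * ∏ i : Fin n, X i ^ (i : ℕ) ∈
      esymmIdeal K n := by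
  let π := Ideal.Quotient.mk (esymmIdeal K n)
  -- By Vieta, every lower coefficient is `± e_i`, which vanishes in the quotient.
  have h : ∏ i : Fin n, (Polynomial.X - Polynomial.C (π (X i))) = Polynomial.X ^ n := by
    have := congrArg (Polynomial.map π) (Multiset.prod_X_sub_X_eq_sum_esymm
      (Finset.univ.val.map fun i : Fin n => (X i : MvPolynomial (Fin n) K)))
    rw [Multiset.map_map, Multiset.card_map, Finset.card_val, Finset.card_univ, Fintype.card_fin,
      Finset.sum_range_succ', ← esymm_eq_multiset_esymm] at this
    simp only [esymm_zero, Polynomial.map_add, Polynomial.map_sum] at this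
    rw [Finset.sum_eq_zero, zero_add] at this
    · change Polynomial.map π (∏ i : Fin n, (Polynomial.X - Polynomial.C (X i))) = _ at this
      simpa [Polynomial.map_prod] using this
    · intro k hk
      have : π (esymm (Fin n) K (k + 1)) = 0 := Ideal.Quotient.eq_zero_iff_mem.2
        (Ideal.subset_span ⟨⟨k, Finset.mem_range.1 hk⟩, rfl⟩)
      simp [this]
  have := prod_prod_Iio_sub_of_prod_X_sub_C_eq (fun i => π (X i)) h
  rw [← Ideal.Quotient.eq]
  simpa [alternatingDelta] using this

end Alternating

/-! ### The trace, and `Δ` outside the ideal of the `e_i` -/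

section Trace

variable {K : Type*} [Field K] {n : ℕ}

/-- The trace `f ↦ ∑ σ f`, over the even permutations `σ`, onto the alternating invariants. -/
noncomputable def alternatingTrace (K : Type*) [Field K] (n : ℕ) :
    MvPolynomial (Fin n) K →ₗ[alternatingInvariants K n] alternatingInvariants K n where
  toFun f := ⟨∑ σ : alternatingGroup (Fin n), rename (σ : Equiv.Perm (Fin n)) f, fun τ hτ => by
    rw [map_sum]
    refine Fintype.sum_equiv (Equiv.mulLeft (⟨τ, hτ⟩ : alternatingGroup (Fin n))) _ _ fun σ => ?_
    rw [rename_rename]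
    rfl⟩
  map_add' f g := by
    ext1
    simp [Finset.sum_add_distrib]
  map_smul' s f := by
    ext1
    simp only [Algebra.smul_def, map_mul, RingHom.id_apply, Algebra.algebraMap_self_apply]
    simp only [MulMemClass.coe_mul, Finset.mul_sum]
    exact Finset.sum_congr rfl fun σ _ => congrArg (· * _) (s.2 σ σ.2)

theorem coe_alternatingTrace (f : MvPolynomial (Fin n) K) :
    (alternatingTrace K n f : MvPolynomial (Fin n) K) =
      ∑ σ : alternatingGroup (Fin n), rename (σ : Equiv.Perm (Fin n)) f := rfl

theorem alternatingTrace_one (hn : 2 ≤ n) :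
    alternatingTrace K n 1 = algebraMap K _ (n.factorial / 2 : ℕ) := by
  have : Nontrivial (Fin n) := Fin.nontrivial_iff_two_le.2 hn
  ext1
  rw [coe_alternatingTrace]
  simp only [map_one, Finset.sum_const, Finset.card_univ, nsmul_one, ← Nat.card_eq_fintype_card,
    nat_card_alternatingGroup, Nat.card_fin, map_natCast]
  rfl

/-- The exponents are distinct, so only the identity fixes the monomial and its coefficient in the
trace is `1`. This works even when the trace of `1` vanishes. -/
theorem alternatingTrace_monomial_ne_zero :
    alternatingTrace K n (monomial (Finsupp.equivFunOnFinite.symm fun i : Fin n => (i : ℕ)) 1) ≠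
      0 := by
  set m : Fin n →₀ ℕ := Finsupp.equivFunOnFinite.symm fun i : Fin n => (i : ℕ) with hm
  intro h
  have h' := congrArg (fun f : alternatingInvariants K n => coeff m (f : MvPolynomial (Fin n) K)) h
  simp only [coe_alternatingTrace, coeff_sum, rename_monomial, coeff_monomial,
    ZeroMemClass.coe_zero, coeff_zero] at h'
  rw [Finset.sum_eq_single 1] at h'
  · simp at h'
  · intro σ _ hσ
    refine if_neg fun hm' => hσ ?_
    ext i
    have := DFunLike.congr_fun hm' ((σ : Equiv.Perm (Fin n)) i)
    rw [Finsupp.mapDomain_apply (σ : Equiv.Perm (Fin n)).injective] at this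
    simpa [hm] using this.symm
  · simp

theorem exists_retraction_of_not_dvd {p : ℕ} [CharP K p] (hn : 2 ≤ n) (h : ¬ p ∣ n.factorial / 2) :
    ∃ f : MvPolynomial (Fin n) K →ₗ[alternatingInvariants K n] alternatingInvariants K n,
      f 1 = 1 := by
  have h0 : ((n.factorial / 2 : ℕ) : K) ≠ 0 := by rwa [Ne, CharP.cast_eq_zero_iff K p]
  refine ⟨LinearMap.mulLeft _ (algebraMap K _ ((n.factorial / 2 : ℕ) : K)⁻¹) ∘ₗ
    alternatingTrace K n, ?_⟩
  rw [LinearMap.comp_apply, alternatingTrace_one hn, LinearMap.mulLeft_apply, ← map_mul,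
    inv_mul_cancel₀ h0,
    map_one]

/-- The ideal `(e_1, …, e_n)` of the ring of alternating invariants. -/
noncomputable def alternatingEsymmIdeal (K : Type*) [Field K] (n : ℕ) :
    Ideal (alternatingInvariants K n) :=
  Ideal.span (Set.range fun i : Fin n => ⟨esymm (Fin n) K ((i : ℕ) + 1),
    (esymm_isSymmetric (Fin n) K _).mem_alternatingInvariants⟩)

theorem map_alternatingEsymmIdeal : (alternatingEsymmIdeal K n).map
    (algebraMap (alternatingInvariants K n) (MvPolynomial (Fin n) K)) = esymmIdeal K n := by
  rw [alternatingEsymmIdeal, Ideal.map_span, ← Set.range_comp]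
  rfl

/-- If `Δ = ∑ a_k e_k`, subtracting the image under a transposition gives `2Δ = Δ ∑ g_k e_k`.
Cancelling `Δ` gives `2 = ∑ g_k e_k`, whose right side has no constant term. -/
theorem alternatingDelta_notMem_alternatingEsymmIdeal (h2 : (2 : K) ≠ 0) (hn : 2 ≤ n) :
    (⟨alternatingDelta K n, alternatingDelta_mem⟩ : alternatingInvariants K n) ∉
      alternatingEsymmIdeal K n := by
  intro h
  have : Nontrivial (Fin n) := Fin.nontrivial_iff_two_le.2 hn
  obtain ⟨i, j, hij⟩ := exists_pair_ne (Fin n)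
  obtain ⟨a, ha⟩ := Ideal.mem_span_range_iff_exists_fun.1 h
  have ha' := congrArg (fun f : alternatingInvariants K n => (f : MvPolynomial (Fin n) K)) ha
  simp only [AddSubmonoidClass.coe_finsetSum, MulMemClass.coe_mul] at ha'
  choose g _ hg using fun k => sub_rename_swap_eq_mul h2 (a k).2 hij
  have hswap := congrArg (rename (Equiv.swap i j)) ha'
  simp only [map_sum, map_mul, rename_alternatingDelta, Equiv.Perm.sign_swap hij,
    esymm_isSymmetric (Fin n) K _ (Equiv.swap i j)] at hswap
  have h2Δ : alternatingDelta K n * ∑ k : Fin n, g k * esymm (Fin n) K (k + 1) =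
      alternatingDelta K n * 2 := by
    rw [Finset.mul_sum]
    simp only [← mul_assoc, ← hg, sub_mul, Finset.sum_sub_distrib, hswap, ha']
    push_cast
    ring
  have := congrArg constantCoeff (mul_left_cancel₀ alternatingDelta_ne_zero h2Δ)
  rw [map_sum, Finset.sum_eq_zero, map_ofNat] at this
  · exact h2 this.symm
  · intro k _
    rw [map_mul]
    refine mul_eq_zero_of_right _ ?_
    rw [esymm, map_sum]
    refine Finset.sum_eq_zero fun s hs => ?_
    have hs' : s.Nonempty := by
      rw [← Finset.card_pos, (Finset.mem_powersetCard.1 hs).2]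
      exact Nat.succ_pos _
    obtain ⟨l, hl⟩ := hs'
    rw [map_prod]
    exact Finset.prod_eq_zero hl (by simp)

end Trace

/-- The variables are indexed from `0`, so that the product in the last but one clause is
`X_n^(n-1) X_(n-1)^(n-2) ⋯ X_2` in the usual numbering. The division `n ! / 2` is exact. -/
theorem mainTheorem3 (K : Type*) [Field K] (p : ℕ) [Fact p.Prime] [CharP K p] (hp : Odd p)
    (n : ℕ) (hn : 2 ≤ n) :
    alternatingInvariants K n =
        Algebra.adjoin K ((Set.range fun i : Fin n => esymm (Fin n) K ((i : ℕ) + 1)) ∪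
          {alternatingDelta K n}) ∧
      (IsFRegular p (alternatingInvariants K n) ↔
        IsDirectSummandOf (alternatingInvariants K n) (MvPolynomial (Fin n) K)) ∧
      (IsFRegular p (alternatingInvariants K n) ↔ ¬ p ∣ n.factorial / 2) ∧
      alternatingDelta K n -
          (n.factorial : MvPolynomial (Fin n) K) * ∏ i : Fin n, X i ^ (i : ℕ) ∈
        esymmIdeal K n ∧
      (p ∣ n.factorial → alternatingDelta K n ∈ esymmIdeal K n) := by
  have hpp : p.Prime := Fact.out
  have h2 : (2 : K) ≠ 0 := by
    intro h
    have := (CharP.cast_eq_zero_iff K p 2).1 (by exact_mod_cast h)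
    rw [Nat.prime_dvd_prime_iff_eq hpp Nat.prime_two] at this
    subst this
    exact absurd hp (by decide)
  have hΔ : p ∣ n.factorial → alternatingDelta K n ∈ esymmIdeal K n := by
    intro h
    have := alternatingDelta_sub_mem_esymmIdeal (K := K) (n := n)
    rwa [(CharP.cast_eq_zero_iff (MvPolynomial (Fin n) K) p _).2 h, zero_mul, sub_zero] at this
  have hΔ' : p ∣ n.factorial / 2 →
      algebraMap (alternatingInvariants K n) (MvPolynomial (Fin n) K)
        ⟨alternatingDelta K n, alternatingDelta_mem⟩ ∈
        (alternatingEsymmIdeal K n).map (algebraMap _ _) := by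
    intro h
    rw [map_alternatingEsymmIdeal]
    exact hΔ (h.trans (Nat.div_dvd_of_dvd (Nat.dvd_factorial two_pos hn)))
  have hreg : IsFRegular p (alternatingInvariants K n) ↔ ¬ p ∣ n.factorial / 2 := by
    refine ⟨fun hF h => ?_, fun h => ?_⟩
    · exact alternatingDelta_notMem_alternatingEsymmIdeal h2 hn (hF.mem_of_mem_tightClosure
        (mem_tightClosure_of_mem_map p (alternatingTrace K n) alternatingTrace_monomial_ne_zero
          (hΔ' h)))
    · obtain ⟨f, hf⟩ := exists_retraction_of_not_dvd (K := K) hn h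
      exact ((hasFrobeniusSplittings p).of_retraction f hf).isFRegular hpp.ne_zero
  refine ⟨alternatingInvariants_eq_adjoin h2 hn, hreg.trans ?_, hreg,
    alternatingDelta_sub_mem_esymmIdeal, hΔ⟩
  rw [isDirectSummandOf_iff]
  refine ⟨exists_retraction_of_not_dvd hn, ?_⟩
  rintro ⟨f, hf⟩ h
  refine alternatingDelta_notMem_alternatingEsymmIdeal (K := K) h2 hn ?_
  -- The retraction `f` fixes `Δ` and maps the extended ideal back into the original one.
  have := f.apply_mul_mem_of_mem_map (hΔ' h) 1
  rwa [mul_comm, ← Algebra.smul_def, map_smul, hf, smul_eq_mul, mul_one] at this
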